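/- **Setting.** Let $f:\mathbb{R}^n\to\mathbb{R}$ be twice continuously differentiable (possibly non-convex), let $\psi:\mathbb{R}^n\to\mathbb{R}\cup\{+\infty\}$ be proper, closed and convex, $Q=\operatorname{dom}\psi$, $F=f+\psi$, and assume $F^\star=\inf_{x\in Q}F(x)>-\infty$. Norms are Euclidean for vectors and spectral for matrices. Assume A1: $\|\nabla^2f(y)-\nabla^2f(x)\|\le L\|y-x\|$ for all $x,y\in\mathbb{R}^n$, with $L\ge 0$. Let $x_0\in Q$, $\tau_0>0$, $\epsilon>0$ and an integer $m\ge1$ be given. **Procedure $\mathrm{CubicSteps}(x,B,\sigma,m,\epsilon)$.** Put $y_0=x$. For $t=0,1,\dots,m-1$: with $M(y)=f(y_t)+\langle\nabla f(y_t),y-y_t\rangle+\frac12\langle B(y-y_t),y-y_t\rangle+\frac\sigma6\|y-y_t\|^3$, compute any point $y_{t+1}$ and any $\psi'(y_{t+1})\in\partial\psi(y_{t+1})$ with $M(y_{t+1})+\psi(y_{t+1})\le F(y_t)$ and $\|\nabla M(y_{t+1})+\psi'(y_{t+1})\|\le\frac\sigma4\|y_{t+1}-y_t\|^2$; if $\|\nabla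 f(y_{t+1})+\psi'(y_{t+1})\|\le\epsilon$, return $(y_{t+1},\text{solution})$; otherwise, if $F(y_0)-F(y_{t+1})<\frac{\epsilon^{3/2}}{384\,\sigma^{1/2}}(t+1)$, return $(y_{t+1},\text{halt})$. If all $m$ steps are completed, return $(y_m,\text{success})$. **First-order CNM (Hessian-free, lazy).** At iteration $k=0,1,\dots$, for $\ell=0,1,2,\dots$: put $$\sigma_{k,\ell}=2^4\left(\tfrac23\right)^{1/3}(2^\ell\tau_k)\,m,\qquad h_{k,\ell}=\left[\frac{3\,\sigma_{k,\ell}^{3/2}\epsilon^{3/2}}{2^7\cdot192\,n^{3/2}(2^\ell\tau_k)^3}\right]^{1/3},$$ let $A_{k,\ell}$ be the matrix with columns $\big(\nabla f(x_k+h_{k,\ell}e_j)-\nabla f(x_k)\big)/h_{k,\ell}$, $j=1,\dots,n$, let $B_{k,\ell}=\frac12(A_{k,\ell}+A_{k,\ell}^\top)$, and $(\hat x_{k,\ell},\alpha_{k,\ell})=\mathrm{CubicSteps}(x_k,B_{k,\ell},\sigma_{k,\ell},m,\epsilon)$; let $\ell_k$ be the first $\ell$ with $\alpha_{k,\ell}\neq\text{halt}$,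 and set $x_{k+1}=\hat x_{k,\ell_k}$. If $\alpha_{k,\ell_k}=\text{success}$, set $\tau_{k+1}=\max\{\tau_0,2^{\ell_k-1}\tau_k\}$ and go to iteration $k+1$; if $\alpha_{k,\ell_k}=\text{solution}$, stop. Let $T(\epsilon)$ be the first index $T\ge0$ such that $\|\nabla f(x_T)+\psi'(x_T)\|\le\epsilon$ for a certain $\psi'(x_T)\in\partial\psi(x_T)$. Let $\mathrm{FO}_T$ be the total number of function and gradient evaluations, that is, of calls of the oracle $x\mapsto(f(x),\nabla f(x))$, during the first $T$ iterations: iteration $k$ makes one call at $x_k$, and for each $\ell\le\ell_k$ it makes $n+1$ calls to form $A_{k,\ell}$ and one call at each of the points $y_0,y_1,\dots$ computed by CubicSteps. Let $\delta=1$ if the method stops (with status "solution") upon computing $x_{T(\epsilon)}$, and $\delta=0$ otherwise. **Theorem.** For every execution of the method, $T(\epsilon)$ is well defined and finite, $$T(\epsilon)\le\frac{384\cdot2^{5/2}\left(\frac23\right)^{1/6}\max\{\tau_0,L\}^{1/2}(F(x_0)-F^\star)}{\sqrt m}\,\epsilon^{-3/2}+\delta,$$ and $$\mathrm{FO}_{T(\epsilon)}\le\frac{5+2(n+m)}{\sqrt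 m}\,384\cdot2^{5/2}\left(\tfrac23\right)^{1/6}\max\{\tau_0,L\}^{1/2}(F(x_0)-F^\star)\,\epsilon^{-3/2}+[2+n+m]\log_2\frac{\max\{\tau_0,L\}}{\tau_0}+[5+2(n+m)]\,\delta .$$ -/

import Mathlib

namespace LazyCNM

/-- The space `ℝⁿ` with the standard Euclidean norm. -/
abbrev Vec (n : ℕ) : Type := EuclideanSpace ℝ (Fin n)

/-! ### The composite problem `min F = f + ψ` -/

/-- The effective domain `Q = dom ψ`. -/
def dom {n : ℕ} (ψ : Vec n → EReal) : Set (Vec n) := {x | ψ x ≠ ⊤}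

/-- `ψ : ℝⁿ → ℝ ∪ {+∞}` is proper, closed and convex. -/
structure ProperClosedConvex {n : ℕ} (ψ : Vec n → EReal) : Prop where
  ne_bot : ∀ x, ψ x ≠ ⊥
  dom_nonempty : (dom ψ).Nonempty
  closed : LowerSemicontinuous ψ
  convex : Convex ℝ {p : Vec n × ℝ | ψ p.1 ≤ (p.2 : EReal)}

/-- The convex subdifferential `∂ψ(x)`, which is empty outside of `dom ψ`. -/
def subdifferential {n : ℕ} (ψ : Vec n → EReal) (x : Vec n) : Set (Vec n) :=
  {s | x ∈ dom ψ ∧ ∀ y, ψ x + ((inner ℝ s (y - x) : ℝ) : EReal) ≤ ψ y}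

/-- The objective `F = f + ψ` as a real number; it is only used at points of `dom ψ`. -/
noncomputable def objective {n : ℕ} (f : Vec n → ℝ) (ψ : Vec n → EReal) (x : Vec n) : ℝ :=
  f x + (ψ x).toReal

/-- The optimal value `F⋆ = inf_{x ∈ Q} F(x)`. -/
noncomputable def optimalValue {n : ℕ} (f : Vec n → ℝ) (ψ : Vec n → EReal) : ℝ :=
  sInf (objective f ψ '' dom ψ)

/-- The Hessian `∇²f(x)`, as a linear operator: its operator norm is the spectral norm. -/
noncomputable def hessian {n : ℕ} (f : Vec n → ℝ) (x : Vec n) : Vec n →L[ℝ] Vec n :=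
  fderiv ℝ (gradient f) x

/-- The Hessian of `f` is Lipschitz continuous with constant `L` (assumption A1). -/
def LipschitzHessian {n : ℕ} (f : Vec n → ℝ) (L : ℝ) : Prop :=
  ∀ x y : Vec n, ‖hessian f y - hessian f x‖ ≤ L * ‖y - x‖

/-- `‖∇f(x) + ψ'(x)‖ ≤ ε` for a certain `ψ'(x) ∈ ∂ψ(x)`. -/
def IsApproxStationary {n : ℕ} (f : Vec n → ℝ) (ψ : Vec n → EReal) (ε : ℝ) (x : Vec n) : Prop :=
  ∃ s ∈ subdifferential ψ x, ‖gradient f x + s‖ ≤ ε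

/-! ### The procedure `CubicSteps` -/

/-- The model
`M(y) = f(x) + ⟨∇f(x), y - x⟩ + ½ ⟨B (y - x), y - x⟩ + σ/6 ‖y - x‖³`. -/
noncomputable def cubicModel {n : ℕ} (f : Vec n → ℝ) (B : Matrix (Fin n) (Fin n) ℝ) (σ : ℝ)
    (x y : Vec n) : ℝ :=
  f x + inner ℝ (gradient f x) (y - x)
    + 1 / 2 * inner ℝ (Matrix.toEuclideanLin B (y - x)) (y - x)
    + σ / 6 * ‖y - x‖ ^ 3

/-- `x'` is an admissible inexact solution of `min_y { M(y) + ψ(y) }` for the model `M` around `x`,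
certified by the subgradient `s = ψ'(x')`. -/
structure IsInexactCubicStep {n : ℕ} (f : Vec n → ℝ) (ψ : Vec n → EReal)
    (B : Matrix (Fin n) (Fin n) ℝ) (σ : ℝ) (x x' s : Vec n) : Prop where
  subgradient : s ∈ subdifferential ψ x'
  decrease : cubicModel f B σ x x' + (ψ x').toReal ≤ objective f ψ x
  small_gradient : ‖gradient (cubicModel f B σ x) x' + s‖ ≤ σ / 4 * ‖x' - x‖ ^ 2

/-- The status returned by `CubicSteps`. -/
inductive Status
  | success
  | solution
  | halt

/-- The test in Step 4 of `CubicSteps`, performed at the point `x' = x_{t+1}`. -/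
def SufficientProgress {n : ℕ} (f : Vec n → ℝ) (ψ : Vec n → EReal) (σ ε : ℝ) (x₀ : Vec n)
    (t : ℕ) (x' : Vec n) : Prop :=
  objective f ψ x₀ - objective f ψ x' ≥
    ε ^ (3 / 2 : ℝ) / (384 * σ ^ (1 / 2 : ℝ)) * ((t : ℝ) + 1)

/-- `CubicStepsFrom f ψ B σ m ε x₀ t x x̂ α q`: the loop of `CubicSteps(x₀, B, σ, m, ε)`, when it is
in Step 1 with counter `t` and current point `x_t = x`, can return `(x̂, α)`, calling from there on
the first-order oracle `y ↦ (f(y), ∇f(y))` at the points of the list `q`, that is, once at every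
newly computed point. The relation is not functional since the inexact solution of a subproblem is
not unique. -/
inductive CubicStepsFrom {n : ℕ} (f : Vec n → ℝ) (ψ : Vec n → EReal)
    (B : Matrix (Fin n) (Fin n) ℝ) (σ : ℝ) (m : ℕ) (ε : ℝ) (x₀ : Vec n) :
    ℕ → Vec n → Vec n → Status → List (Vec n) → Prop
  | success {x : Vec n} :
      CubicStepsFrom f ψ B σ m ε x₀ m x x Status.success []
  | solution {t : ℕ} {x x' s : Vec n} (ht : t ≠ m)
      (hstep : IsInexactCubicStep f ψ B σ x x' s)
      (hsol : ‖gradient f x' + s‖ ≤ ε) :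
      CubicStepsFrom f ψ B σ m ε x₀ t x x' Status.solution [x']
  | halt {t : ℕ} {x x' s : Vec n} (ht : t ≠ m)
      (hstep : IsInexactCubicStep f ψ B σ x x' s)
      (hsol : ¬ ‖gradient f x' + s‖ ≤ ε)
      (hprog : ¬ SufficientProgress f ψ σ ε x₀ t x') :
      CubicStepsFrom f ψ B σ m ε x₀ t x x' Status.halt [x']
  | next {t : ℕ} {x x' s xhat : Vec n} {α : Status} {q : List (Vec n)} (ht : t ≠ m)
      (hstep : IsInexactCubicStep f ψ B σ x x' s)
      (hsol : ¬ ‖gradient f x' + s‖ ≤ ε)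
      (hprog : SufficientProgress f ψ σ ε x₀ t x')
      (hnext : CubicStepsFrom f ψ B σ m ε x₀ (t + 1) x' xhat α q) :
      CubicStepsFrom f ψ B σ m ε x₀ t x xhat α (x' :: q)

/-- `(x̂, α)` is a possible output of `CubicSteps(x, B, σ, m, ε)`; the oracle is called at the
points of `x :: q`. -/
def CubicSteps {n : ℕ} (f : Vec n → ℝ) (ψ : Vec n → EReal)
    (B : Matrix (Fin n) (Fin n) ℝ) (σ : ℝ) (m : ℕ) (ε : ℝ)
    (x xhat : Vec n) (α : Status) (q : List (Vec n)) : Prop :=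
  CubicStepsFrom f ψ B σ m ε x 0 x xhat α q

/-! ### The first-order CNM -/

/-- The regularization parameter `σ_{k,ℓ}`, where `τ = τ_k`. -/
noncomputable def sigmaParam (m : ℕ) (τ : ℝ) (ℓ : ℕ) : ℝ :=
  2 ^ 4 * (2 / 3 : ℝ) ^ (1 / 3 : ℝ) * (2 ^ ℓ * τ) * m

/-- The finite difference parameter `h_{k,ℓ}`, where `τ = τ_k`. -/
noncomputable def hParam (n m : ℕ) (ε τ : ℝ) (ℓ : ℕ) : ℝ :=
  (3 * sigmaParam m τ ℓ ^ (3 / 2 : ℝ) * ε ^ (3 / 2 : ℝ) /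
    (2 ^ 7 * 192 * (n : ℝ) ^ (3 / 2 : ℝ) * (2 ^ ℓ * τ) ^ 3)) ^ (1 / 3 : ℝ)

/-- The matrix `A` whose `j`-th column is `(∇f(x + h e_j) - ∇f(x)) / h`. -/
noncomputable def fdMatrix {n : ℕ} (f : Vec n → ℝ) (x : Vec n) (h : ℝ) :
    Matrix (Fin n) (Fin n) ℝ :=
  Matrix.of fun i j => (gradient f (x + h • EuclideanSpace.single j 1) i - gradient f x i) / h

/-- The finite difference Hessian `B = ½ (A + Aᵀ)`. -/
noncomputable def fdHessian {n : ℕ} (f : Vec n → ℝ) (x : Vec n) (h : ℝ) :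
    Matrix (Fin n) (Fin n) ℝ :=
  (1 / 2 : ℝ) • (fdMatrix f x h + (fdMatrix f x h).transpose)

/-- The state of the method before an attempt (Steps 1.1 - 2). `x = x_k` is the current iterate,
`τ = τ_k`, `ℓ` is the adaptive search index, `queries` lists all calls of the first-order oracle
made so far, and `stopped` tells whether the method has stopped (at its last iterate `x_k`). -/
structure State (n : ℕ) where
  k : ℕ
  ℓ : ℕ
  x : Vec n
  τ : ℝ
  queries : List (Vec n)
  stopped : Bool

/-- The oracle calls of one attempt: one call at `x_k` when the iteration `k` starts (`ℓ = 0`),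
the `n + 1` calls for the finite difference Hessian, and those of `CubicSteps`. No call is saved by
reusing the result of an earlier one. -/
noncomputable def attemptQueries {n : ℕ} (m : ℕ) (ε : ℝ) (S : State n) (q : List (Vec n)) :
    List (Vec n) :=
  (if S.ℓ = 0 then [S.x] else []) ++
    (S.x :: List.ofFn fun j : Fin n =>
      S.x + hParam n m ε S.τ S.ℓ • EuclideanSpace.single j (1 : ℝ)) ++
    (S.x :: q)

/-- `CubicSteps` as it is called in Step 1.2 in the state `S`. -/
def InnerCall {n : ℕ} (f : Vec n → ℝ) (ψ : Vec n → EReal) (m : ℕ) (ε : ℝ)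
    (S : State n) (xhat : Vec n) (α : Status) (q : List (Vec n)) : Prop :=
  CubicSteps f ψ (fdHessian f S.x (hParam n m ε S.τ S.ℓ)) (sigmaParam m S.τ S.ℓ) m ε
    S.x xhat α q

/-- One attempt (Steps 1.1 - 4) of the method: an insufficient result increases `ℓ`, a successful
one starts the next iteration, and a solution stops the method. -/
inductive Attempt {n : ℕ} (f : Vec n → ℝ) (ψ : Vec n → EReal) (m : ℕ) (τ₀ ε : ℝ) :
    State n → State n → Prop
  | halt {S : State n} {xhat : Vec n} {q : List (Vec n)}
      (h : InnerCall f ψ m ε S xhat Status.halt q) :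
      Attempt f ψ m τ₀ ε S
        { k := S.k, ℓ := S.ℓ + 1, x := S.x, τ := S.τ,
          queries := S.queries ++ attemptQueries m ε S q, stopped := false }
  | success {S : State n} {xhat : Vec n} {q : List (Vec n)}
      (h : InnerCall f ψ m ε S xhat Status.success q) :
      Attempt f ψ m τ₀ ε S
        { k := S.k + 1, ℓ := 0, x := xhat, τ := max τ₀ ((2 : ℝ) ^ ((S.ℓ : ℤ) - 1) * S.τ),
          queries := S.queries ++ attemptQueries m ε S q, stopped := false }
  | solution {S : State n} {xhat : Vec n} {q : List (Vec n)}
      (h : InnerCall f ψ m ε S xhat Status.solution q) :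
      Attempt f ψ m τ₀ ε S
        { k := S.k + 1, ℓ := 0, x := xhat, τ := S.τ,
          queries := S.queries ++ attemptQueries m ε S q, stopped := true }

/-- `S` is a complete execution of the method from `x₀`: it goes on until the method stops, and the
last state is then repeated. Neither the adaptive search nor the method itself is assumed to
terminate. -/
structure IsExecution {n : ℕ} (f : Vec n → ℝ) (ψ : Vec n → EReal) (m : ℕ) (τ₀ ε : ℝ)
    (x₀ : Vec n) (S : ℕ → State n) : Prop where
  start : S 0 = { k := 0, ℓ := 0, x := x₀, τ := τ₀, queries := [], stopped := false }
  running : ∀ j, (S j).stopped = false → Attempt f ψ m τ₀ ε (S j) (S (j + 1))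
  ended : ∀ j, (S j).stopped = true → S (j + 1) = S j

end LazyCNM

/-!
The bounds rest on one fact: an attempt with `2 ^ ℓ * τ ≥ L` never ends with the status "halt".
In an inner step from `y` to `y'` of length `r`, the lazy matrix `B` differs from the Hessian at `y`
by at most `δ + L * d`, where `δ` is the error of the finite differences and `d` is the distance
from `y` to the point where `B` was formed. By Taylor's formula the step decreases the objective by
at least `(σ - L) / 6 * r ^ 3 - (δ + L * d) / 2 * r ^ 2`
(`LazyCNM.step_decrease_and_gradient_le`), and if `y'` is not yet accepted, then `ε` is bounded by a
multiple of `σ * r ^ 2 + (δ + L * d) * r`. With `σ ≥ 13 * L * m` and the prescribed `h`, these two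
combine to a decrease of at least `K + σ / 40 * (r ^ 3 - d ^ 3 / m ^ 3)`, where `K` is the quota per
step (`LazyCNM.quota_add_le`). By the power mean inequality `d ^ 3` is at most `m ^ 2` times the sum
of the cubes of the earlier step lengths, so over at most `m` steps the negative terms are absorbed
by the positive ones (`LazyCNM.CubicStepsFrom.ne_halt`).

Consequently `2 ^ ℓ * τ` never exceeds `2 * max τ₀ L`, and each successful outer iteration decreases
the objective by a fixed amount, which bounds their number. A halt raises `log₂ (2 ^ ℓ * τ)` by one
and a success lowers it by at most one, so this logarithm is a potential that bounds the number of
attempts, hence that of oracle calls (`LazyCNM.Invariant.attempt`). Since every attempt calls the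
oracle, the method stops, and the first state whose iterate is approximately stationary begins the
iteration `T(ε)`.
-/

namespace LazyCNM

variable {n : ℕ} {f : Vec n → ℝ} {L : ℝ}

/-! ### Taylor bounds -/

theorem hasFDerivAt_gradient (hf : ContDiff ℝ 2 f) (x : Vec n) :
    HasFDerivAt (gradient f) (hessian f x) x := by
  have h1 : ContDiff ℝ 1 (fderiv ℝ f) := hf.fderiv_right (by norm_num)
  have h2 : Differentiable ℝ (gradient f) :=
    ((InnerProductSpace.toDual ℝ (Vec n)).symm.toContinuousLinearEquiv.contDiff.comp
      h1).differentiable (by norm_num)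
  exact (h2 x).hasFDerivAt

theorem hasFDerivAt_inner_gradient (hf : ContDiff ℝ 2 f) (x : Vec n) :
    HasFDerivAt f (innerSL ℝ (gradient f x)) x := by
  have h := ((hf.differentiable (by norm_num)) x).hasGradientAt.hasFDerivAt
  exact h

theorem hasDerivAt_add_smul (x s : Vec n) (t : ℝ) :
    HasDerivAt (fun t : ℝ => x + t • s) s t := by
  simpa using ((hasDerivAt_id t).smul_const s).const_add x

/-- The Taylor bound for the gradient at all points of a segment. Integrating it once more gives the
bound `le_taylor` on `f`, with the sharp constant. -/
theorem norm_gradient_taylor_segment (hf : ContDiff ℝ 2 f) (hA1 : LipschitzHessian f L)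
    (x s : Vec n) {t : ℝ} (ht : t ∈ Set.Icc (0 : ℝ) 1) :
    ‖gradient f (x + t • s) - gradient f x - t • hessian f x s‖ ≤ L / 2 * ‖s‖ ^ 2 * t ^ 2 := by
  have hd : ∀ t : ℝ, HasDerivAt
      (fun t : ℝ => gradient f (x + t • s) - gradient f x - t • hessian f x s)
      (hessian f (x + t • s) s - hessian f x s) t := by
    intro t
    have h1 := (hasFDerivAt_gradient hf (x + t • s)).comp_hasDerivAt t (hasDerivAt_add_smul x s t)
    have h2 := (hasDerivAt_id t).smul_const (hessian f x s)
    exact ((h1.sub_const (gradient f x)).sub h2).congr_deriv (by simp)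
  refine image_norm_le_of_norm_deriv_right_le_deriv_boundary
    (f := fun t : ℝ => gradient f (x + t • s) - gradient f x - t • hessian f x s)
    (B := fun t => L / 2 * ‖s‖ ^ 2 * t ^ 2) (B' := fun t => L * ‖s‖ ^ 2 * t)
    (fun t _ => (hd t).continuousAt.continuousWithinAt) (fun t _ => (hd t).hasDerivWithinAt)
    (by simp) (fun t => ?_) (fun t ht => ?_) ht
  · exact ((hasDerivAt_pow 2 t).const_mul (L / 2 * ‖s‖ ^ 2)).congr_deriv (by norm_num; ring)
  · rw [← sub_apply]
    refine (ContinuousLinearMap.le_opNorm _ _).trans ?_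
    have h := hA1 x (x + t • s)
    rw [add_sub_cancel_left, norm_smul, Real.norm_of_nonneg ht.1] at h
    calc _ ≤ L * (t * ‖s‖) * ‖s‖ := by gcongr
      _ = _ := by ring

theorem norm_gradient_taylor (hf : ContDiff ℝ 2 f) (hA1 : LipschitzHessian f L) (x y : Vec n) :
    ‖gradient f y - gradient f x - hessian f x (y - x)‖ ≤ L / 2 * ‖y - x‖ ^ 2 := by
  simpa using norm_gradient_taylor_segment hf hA1 x (y - x) (t := 1) (by simp)

theorem le_taylor (hf : ContDiff ℝ 2 f) (hA1 : LipschitzHessian f L) (x y : Vec n) :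
    f y ≤ f x + inner ℝ (gradient f x) (y - x)
      + 1 / 2 * inner ℝ (hessian f x (y - x)) (y - x) + L / 6 * ‖y - x‖ ^ 3 := by
  set s := y - x with hs
  have hd : ∀ t : ℝ, HasDerivAt
      (fun t : ℝ => f (x + t • s) - f x - t * inner ℝ (gradient f x) s
        - t ^ 2 / 2 * inner ℝ (hessian f x s) s)
      (inner ℝ (gradient f (x + t • s) - gradient f x - t • hessian f x s) s) t := by
    intro t
    have h1 := (hasFDerivAt_inner_gradient hf (x + t • s)).comp_hasDerivAt t
      (hasDerivAt_add_smul x s t)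
    have h2 := (hasDerivAt_id t).mul_const (inner ℝ (gradient f x) s)
    have h3 := ((hasDerivAt_pow 2 t).div_const 2).mul_const (inner ℝ (hessian f x s) s)
    refine (((h1.sub_const (f x)).sub h2).sub h3).congr_deriv ?_
    simp only [innerSL_apply_apply, inner_sub_left, real_inner_smul_left]
    norm_num
  have key := image_norm_le_of_norm_deriv_right_le_deriv_boundary
    (f := fun t : ℝ => f (x + t • s) - f x - t * inner ℝ (gradient f x) s
        - t ^ 2 / 2 * inner ℝ (hessian f x s) s)
    (B := fun t => L / 6 * ‖s‖ ^ 3 * t ^ 3) (B' := fun t => L / 2 * ‖s‖ ^ 3 * t ^ 2)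
    (a := 0) (b := 1)
    (fun t _ => (hd t).continuousAt.continuousWithinAt) (fun t _ => (hd t).hasDerivWithinAt)
    (by simp) (fun t =>
      ((hasDerivAt_pow 3 t).const_mul (L / 6 * ‖s‖ ^ 3)).congr_deriv (by norm_num; ring))
    (fun t ht => by
      refine (norm_inner_le_norm _ _).trans ?_
      calc _ ≤ (L / 2 * ‖s‖ ^ 2 * t ^ 2) * ‖s‖ := by
            gcongr
            exact norm_gradient_taylor_segment hf hA1 x s ⟨ht.1, ht.2.le⟩
        _ = _ := by ring) (Set.right_mem_Icc.2 zero_le_one)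
  have hy : x + (1 : ℝ) • s = y := by simp [hs]
  simp only [hy] at key
  have := (le_abs_self _).trans key
  linarith

/-! ### The finite difference Hessian -/

/-- Schwarz's theorem, in terms of the gradient. -/
theorem adjoint_hessian (hf : ContDiff ℝ 2 f) (x : Vec n) :
    ContinuousLinearMap.adjoint (hessian f x) = hessian f x := by
  have hsymm : IsSymmSndFDerivAt ℝ f x := hf.contDiffAt.isSymmSndFDerivAt (by simp)
  have hrep : ∀ v w : Vec n, inner ℝ (hessian f x v) w = fderiv ℝ (fderiv ℝ f) x v w := by
    intro v w
    have h1 : HasFDerivAt (fun y => inner ℝ (gradient f y) w)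
        ((innerSL ℝ w).comp (hessian f x)) x := by
      have := ((innerSL ℝ w).hasFDerivAt).comp x (hasFDerivAt_gradient hf x)
      refine this.congr_of_eventuallyEq (Filter.Eventually.of_forall fun y => ?_)
      simp
    have h2 : HasFDerivAt (fun y => fderiv ℝ f y w)
        ((fderiv ℝ (fderiv ℝ f) x).flip w) x := by
      have h3 : DifferentiableAt ℝ (fderiv ℝ f) x :=
        ((hf.fderiv_right (m := 1) (by norm_num)).differentiable (by norm_num)) x
      have h4 := h3.hasFDerivAt.clm_apply (hasFDerivAt_const w x)
      refine h4.congr_fderiv ?_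
      ext v; simp
    have h5 := h1.unique (h2.congr_of_eventuallyEq
      (Filter.Eventually.of_forall fun y => inner_gradient_left))
    have h6 := congrArg (fun T : Vec n →L[ℝ] ℝ => T v) h5
    simpa [real_inner_comm] using h6
  refine (ContinuousLinearMap.eq_adjoint_iff _ _).2 (fun v w => ?_) |>.symm
  rw [hrep v w, hsymm v w, ← hrep w v, real_inner_comm]

theorem norm_fdMatrix_sub_hessian_le (hf : ContDiff ℝ 2 f) (hA1 : LipschitzHessian f L)
    (x : Vec n) {h : ℝ} (hL : 0 ≤ L) (hh : 0 < h) :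
    ‖Matrix.toEuclideanCLM (n := Fin n) (𝕜 := ℝ) (fdMatrix f x h) - hessian f x‖
      ≤ √(n : ℝ) * (L * h / 2) := by
  refine ContinuousLinearMap.opNorm_le_bound _ (by positivity) fun v => ?_
  set D := Matrix.toEuclideanCLM (n := Fin n) (𝕜 := ℝ) (fdMatrix f x h) - hessian f x with hD
  -- every column is a difference quotient of the gradient
  have hcol : ∀ j : Fin n, ‖D (EuclideanSpace.single j 1)‖ ≤ L * h / 2 := by
    intro j
    set e : Vec n := EuclideanSpace.single j (1 : ℝ) with he
    have hA : Matrix.toEuclideanCLM (n := Fin n) (𝕜 := ℝ) (fdMatrix f x h) e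
        = h⁻¹ • (gradient f (x + h • e) - gradient f x) := by
      ext i
      simp [he, fdMatrix, div_eq_inv_mul]
    have heq : D e = h⁻¹ • (gradient f (x + h • e) - gradient f x - hessian f x (h • e)) := by
      rw [hD, sub_apply, hA, map_smul, smul_sub h⁻¹ _ (h • _),
        inv_smul_smul₀ hh.ne']
    have ht := norm_gradient_taylor hf hA1 x (x + h • e)
    rw [add_sub_cancel_left, norm_smul, Real.norm_of_nonneg hh.le] at ht
    rw [heq, norm_smul, norm_inv, Real.norm_of_nonneg hh.le]
    have he1 : ‖e‖ = 1 := by simp [he]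
    rw [he1] at ht
    calc _ ≤ h⁻¹ * (L / 2 * (h * 1) ^ 2) := by gcongr
      _ = _ := by field_simp
  have hv : v = ∑ j, v j • (EuclideanSpace.single j (1 : ℝ) : Vec n) := by
    ext i
    simp [Finset.sum_apply, Pi.single_apply]
  -- the Cauchy-Schwarz inequality gives the factor `√n`
  have hl1 : ∑ j, |v j| ≤ √(n : ℝ) * ‖v‖ := by
    refine abs_le_of_sq_le_sq' ?_ (by positivity) |>.2
    rw [mul_pow, Real.sq_sqrt (by positivity), EuclideanSpace.norm_sq_eq]
    have := sq_sum_le_card_mul_sum_sq (s := Finset.univ) (f := fun j => |v j|)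
    simpa using this
  calc ‖D v‖ = ‖∑ j, v j • D (EuclideanSpace.single j 1)‖ := by
        conv_lhs => rw [hv]
        simp only [map_sum, map_smul]
    _ ≤ ∑ j, |v j| * (L * h / 2) := by
        refine norm_sum_le_of_le _ fun j _ => ?_
        rw [norm_smul, Real.norm_eq_abs]
        exact mul_le_mul_of_nonneg_left (hcol j) (abs_nonneg _)
    _ = (∑ j, |v j|) * (L * h / 2) := by rw [Finset.sum_mul]
    _ ≤ (√(n : ℝ) * ‖v‖) * (L * h / 2) := by gcongr
    _ = _ := by ring

theorem adjoint_fdHessian (x : Vec n) (h : ℝ) :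
    ContinuousLinearMap.adjoint (Matrix.toEuclideanCLM (n := Fin n) (𝕜 := ℝ) (fdHessian f x h))
      = Matrix.toEuclideanCLM (n := Fin n) (𝕜 := ℝ) (fdHessian f x h) := by
  rw [← ContinuousLinearMap.star_eq_adjoint, ← map_star, Matrix.star_eq_conjTranspose,
    Matrix.conjTranspose_eq_transpose_of_trivial]
  congr 1
  simp [fdHessian, add_comm]

/-- Since the Hessian is symmetric, passing to the symmetric part of the finite difference matrix
does not increase the error. -/
theorem norm_fdHessian_sub_hessian_le (hf : ContDiff ℝ 2 f) (hA1 : LipschitzHessian f L)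
    (x : Vec n) {h : ℝ} (hL : 0 ≤ L) (hh : 0 < h) :
    ‖Matrix.toEuclideanCLM (n := Fin n) (𝕜 := ℝ) (fdHessian f x h) - hessian f x‖
      ≤ √(n : ℝ) * (L * h / 2) := by
  set A := Matrix.toEuclideanCLM (n := Fin n) (𝕜 := ℝ) (fdMatrix f x h) with hA
  have hB : Matrix.toEuclideanCLM (n := Fin n) (𝕜 := ℝ) (fdHessian f x h)
      = (1 / 2 : ℝ) • (A + ContinuousLinearMap.adjoint A) := by
    rw [fdHessian, map_smul, map_add, ← Matrix.conjTranspose_eq_transpose_of_trivial,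
      ← Matrix.star_eq_conjTranspose, map_star, ContinuousLinearMap.star_eq_adjoint]
  have hsplit : (1 / 2 : ℝ) • (A + ContinuousLinearMap.adjoint A) - hessian f x
      = (1 / 2 : ℝ) • ((A - hessian f x) + ContinuousLinearMap.adjoint (A - hessian f x)) := by
    rw [map_sub, adjoint_hessian hf]
    module
  have hle := norm_fdMatrix_sub_hessian_le hf hA1 x hL hh
  rw [hB, hsplit, norm_smul]
  have hadd := norm_add_le (A - hessian f x) (ContinuousLinearMap.adjoint (A - hessian f x))
  rw [LinearIsometryEquiv.norm_map] at hadd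
  rw [Real.norm_of_nonneg (by norm_num)]
  linarith

/-! ### The gradient of the cubic model -/

theorem gradient_cubicModel {B : Matrix (Fin n) (Fin n) ℝ} (σ : ℝ) (x y : Vec n)
    (hB : ContinuousLinearMap.adjoint (Matrix.toEuclideanCLM (n := Fin n) (𝕜 := ℝ) B)
      = Matrix.toEuclideanCLM (n := Fin n) (𝕜 := ℝ) B) :
    gradient (cubicModel f B σ x) y = gradient f x
      + Matrix.toEuclideanCLM (n := Fin n) (𝕜 := ℝ) B (y - x)
      + (σ / 2 * ‖y - x‖) • (y - x) := by
  set T := Matrix.toEuclideanCLM (n := Fin n) (𝕜 := ℝ) B with hT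
  refine HasGradientAt.gradient ?_
  rw [hasGradientAt_iff_hasFDerivAt]
  have hs : HasFDerivAt (fun y : Vec n => y - x) (ContinuousLinearMap.id ℝ (Vec n)) y :=
    (hasFDerivAt_id y).sub_const x
  have h1 := ((innerSL ℝ (gradient f x)).hasFDerivAt).comp y hs
  have h2 := ((T.hasFDerivAt.comp y hs).inner ℝ hs).const_mul (1 / 2)
  have h3 := ((hasFDerivAt_norm_rpow (y - x) (p := 3) (by norm_num)).comp y hs).const_mul (σ / 6)
  have h := ((h1.const_add (f x)).add h2).add h3
  have hfun : cubicModel f B σ x = fun y => f x + inner ℝ (gradient f x) (y - x)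
      + 1 / 2 * inner ℝ (T (y - x)) (y - x) + σ / 6 * ‖y - x‖ ^ (3 : ℝ) := by
    ext z
    simp only [cubicModel]
    norm_cast
  rw [hfun]
  refine h.congr_fderiv ?_
  ext v
  have hTs : inner ℝ (T v) (y - x) = inner ℝ (T (y - x)) v := by
    rw [← ContinuousLinearMap.adjoint_inner_right, hB, real_inner_comm]
  simp only [ContinuousLinearMap.comp_id, Function.comp_apply, add_apply,
    smul_apply, innerSL_apply_apply, smul_eq_mul, ContinuousLinearMap.comp_apply,
    ContinuousLinearMap.prod_apply, fderivInnerCLM_apply, ContinuousLinearMap.id_apply, hTs,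
    InnerProductSpace.toDual_apply_apply, inner_add_left, real_inner_smul_left]
  norm_num
  ring

/-! ### Progress of one cubic step -/

/-- The decrease of the objective that `CubicSteps` requires per inner step. -/
noncomputable def quota (σ ε : ℝ) : ℝ := ε ^ (3 / 2 : ℝ) / (384 * σ ^ (1 / 2 : ℝ))

theorem quota_pos {σ ε : ℝ} (hσ : 0 < σ) (hε : 0 < ε) : 0 < quota σ ε := by
  unfold quota; positivity

theorem quota_le {σ ε w : ℝ} (hσ : 0 < σ) (hε : 0 ≤ ε) (hw : 0 ≤ w) (h : ε ≤ σ * w ^ 2) :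
    quota σ ε ≤ σ * w ^ 3 / 384 := by
  have h1 : ε ^ (3 / 2 : ℝ) ≤ σ ^ (3 / 2 : ℝ) * w ^ 3 := by
    refine (Real.rpow_le_rpow hε h (by norm_num)).trans_eq ?_
    rw [Real.mul_rpow hσ.le (by positivity), ← Real.rpow_natCast w 2, ← Real.rpow_mul hw,
      ← Real.rpow_natCast w 3]
    norm_num
  have h2 : σ ^ (3 / 2 : ℝ) = σ * σ ^ (1 / 2 : ℝ) := by
    rw [← Real.rpow_one_add' hσ.le (by norm_num)]
    norm_num
  rw [quota, div_le_div_iff₀ (by positivity) (by norm_num)]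
  rw [h2] at h1
  nlinarith [h1]

/-- A step `r = ‖x' - x‖` with a matrix of error at most `E` decreases the objective by a multiple
of `σ * r ^ 3`, up to `E * r ^ 2`, and ends at a point where the gradient is of order
`σ * r ^ 2 + E * r`. -/
theorem step_decrease_and_gradient_le {ψ : Vec n → EReal} {B : Matrix (Fin n) (Fin n) ℝ}
    {σ E : ℝ} {x x' s : Vec n} (hf : ContDiff ℝ 2 f) (hA1 : LipschitzHessian f L)
    (hB : ContinuousLinearMap.adjoint (Matrix.toEuclideanCLM (n := Fin n) (𝕜 := ℝ) B)
      = Matrix.toEuclideanCLM (n := Fin n) (𝕜 := ℝ) B)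
    (hE : ‖Matrix.toEuclideanCLM (n := Fin n) (𝕜 := ℝ) B - hessian f x‖ ≤ E) (hσ : 0 ≤ σ)
    (h : IsInexactCubicStep f ψ B σ x x' s) :
    (σ - L) / 6 * ‖x' - x‖ ^ 3 - E / 2 * ‖x' - x‖ ^ 2 ≤ objective f ψ x - objective f ψ x' ∧
      ‖gradient f x' + s‖ ≤ (L / 2 + 3 * σ / 4) * ‖x' - x‖ ^ 2 + E * ‖x' - x‖ := by
  set T := Matrix.toEuclideanCLM (n := Fin n) (𝕜 := ℝ) B with hT
  set d := x' - x with hd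
  have hTd : ‖(T - hessian f x) d‖ ≤ E * ‖d‖ :=
    ((T - hessian f x).le_opNorm d).trans (by gcongr)
  constructor
  · have h1 := le_taylor hf hA1 x x'
    have h2 := h.decrease
    have h3 : inner ℝ (hessian f x d) d - inner ℝ (T d) d ≤ E * ‖d‖ ^ 2 := by
      rw [← inner_sub_left]
      refine (real_inner_le_norm _ _).trans ?_
      rw [← norm_neg, neg_sub, ← sub_apply, pow_two, ← mul_assoc]
      gcongr
    have h4 : Matrix.toEuclideanLin B d = T d := rfl
    rw [cubicModel, ← hd, h4] at h2
    rw [← hd] at h1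
    unfold objective at h2 ⊢
    linarith
  · have hg := h.small_gradient
    rw [gradient_cubicModel σ x x' hB, ← hd, ← hT] at hg
    have hsplit : gradient f x' + s
        = (gradient f x + T d + (σ / 2 * ‖d‖) • d + s)
          + (gradient f x' - gradient f x - hessian f x d)
          - ((T - hessian f x) d) - (σ / 2 * ‖d‖) • d := by
      rw [sub_apply]; abel
    have ht := norm_gradient_taylor hf hA1 x x'
    rw [← hd] at ht
    have hc : ‖(σ / 2 * ‖d‖) • d‖ = σ / 2 * ‖d‖ ^ 2 := by
      rw [norm_smul, Real.norm_of_nonneg (by positivity)]; ring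
    rw [hsplit]
    refine (norm_sub_le _ _).trans ?_
    refine (add_le_add_left ((norm_sub_le _ _).trans
      (add_le_add_left (norm_add_le _ _) _)) _).trans ?_
    rw [hc]
    linarith

/-- The scalar inequality behind the method. Here `r` is the length of a step that starts at
distance `d` from the point where the Hessian was approximated with error `δ`. The constants `13`
and `170` are round lower bounds for `16 * (2 / 3) ^ (1 / 3)` and `2 ^ 16 / 384`, which come from
the choice of `σ` and `h`; the inequality is far from tight. -/
theorem quota_add_le {σ ε δ r d D : ℝ} {m : ℕ} (hm : 1 ≤ m) (hσ : 0 < σ) (hε : 0 < ε)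
    (hL : 0 ≤ L) (hLm : L * m ≤ σ / 13) (hδ : 0 ≤ δ) (hδ3 : δ ^ 3 ≤ σ ^ 2 * quota σ ε / 170)
    (hr : 0 ≤ r) (hd : 0 ≤ d)
    (hD : (σ - L) / 6 * r ^ 3 - (δ + L * d) / 2 * r ^ 2 ≤ D)
    (hg : ε ≤ (L / 2 + 3 * σ / 4) * r ^ 2 + (δ + L * d) * r) :
    quota σ ε + σ / 40 * (r ^ 3 - d ^ 3 / m ^ 3) ≤ D := by
  have hm1 : (1 : ℝ) ≤ m := by exact_mod_cast hm
  have hL13 : L ≤ σ / 13 := by nlinarith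
  -- `u` is the error of the matrix in units of `σ`, comparable with the length `r`
  obtain ⟨u, hu⟩ : ∃ u, δ + L * d = σ * u := ⟨(δ + L * d) / σ, by field_simp⟩
  have hu0 : 0 ≤ u := by
    have : 0 ≤ σ * u := hu ▸ by positivity
    exact nonneg_of_mul_nonneg_right this hσ
  rw [hu] at hD hg
  have hK : quota σ ε ≤ σ * (r ^ 3 + u ^ 3) / 96 := by
    have h1 : quota σ ε ≤ σ * (r + u) ^ 3 / 384 := by
      refine quota_le hσ hε.le (by positivity) (hg.trans ?_)
      nlinarith [mul_nonneg hσ.le (mul_nonneg hu0 hr), mul_nonneg hσ.le (sq_nonneg u),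
        mul_le_mul_of_nonneg_right hL13 (sq_nonneg r), mul_nonneg hσ.le (sq_nonneg r)]
    have h2 : (r + u) ^ 3 ≤ 4 * (r ^ 3 + u ^ 3) := by
      nlinarith [mul_nonneg (add_nonneg hr hu0) (sq_nonneg (r - u))]
    nlinarith
  -- Young's inequality absorbs the error term into the cubic terms
  have hyoung : u * r ^ 2 / 2 ≤ r ^ 3 / 10 + 2 * u ^ 3 := by
    nlinarith [mul_nonneg (add_nonneg hr hu0) (sq_nonneg (r - 3 * u)), pow_nonneg hr 3,
      pow_nonneg hu0 3, mul_nonneg hr (sq_nonneg (r - 3 * u)),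
      mul_nonneg hu0 (sq_nonneg (r - 3 * u))]
  have hLd : (L * d) ^ 3 ≤ σ ^ 3 * (d ^ 3 / m ^ 3) / 2197 := by
    have h1 : L * d ≤ σ * (d / m) / 13 := by
      have : L ≤ σ / 13 / m := by rwa [le_div_iff₀ (by positivity)]
      calc L * d ≤ σ / 13 / m * d := by gcongr
        _ = _ := by ring
    calc (L * d) ^ 3 ≤ (σ * (d / m) / 13) ^ 3 := by gcongr
      _ = _ := by rw [← div_pow]; ring
  have hu3 : σ * u ^ 3 ≤ 4 * quota σ ε / 170 + 4 * σ * (d ^ 3 / m ^ 3) / 2197 := by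
    have h1 : (δ + L * d) ^ 3 ≤ 4 * (δ ^ 3 + (L * d) ^ 3) := by
      have h0 : 0 ≤ L * d := by positivity
      nlinarith [mul_nonneg (add_nonneg hδ h0) (sq_nonneg (δ - L * d))]
    rw [hu] at h1
    refine le_of_mul_le_mul_left ?_ (show 0 < σ ^ 2 by positivity)
    nlinarith
  have hK0 := quota_pos hσ hε
  have hq : 0 ≤ σ * (d ^ 3 / m ^ 3) := by positivity
  have hr3 : 0 ≤ σ * r ^ 3 := by positivity
  have hLr : L * r ^ 3 ≤ σ / 13 * r ^ 3 := by gcongr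
  have hy : σ * (u * r ^ 2 / 2) ≤ σ * (r ^ 3 / 10 + 2 * u ^ 3) := by gcongr
  linarith

/-! ### `CubicSteps` -/

theorem CubicStepsFrom.mem_dom {ψ : Vec n → EReal} {B : Matrix (Fin n) (Fin n) ℝ} {σ ε : ℝ}
    {m t : ℕ} {x₀ x xhat : Vec n} {α : Status} {q : List (Vec n)}
    (h : CubicStepsFrom f ψ B σ m ε x₀ t x xhat α q) (hx : x ∈ dom ψ) : xhat ∈ dom ψ := by
  induction h with
  | success => exact hx
  | solution ht hstep hsol => exact hstep.subgradient.1
  | halt ht hstep hsol hprog => exact hstep.subgradient.1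
  | next ht hstep hsol hprog hnext ih => exact ih hstep.subgradient.1

theorem CubicStepsFrom.length_le {ψ : Vec n → EReal} {B : Matrix (Fin n) (Fin n) ℝ} {σ ε : ℝ}
    {m t : ℕ} {x₀ x xhat : Vec n} {α : Status} {q : List (Vec n)}
    (h : CubicStepsFrom f ψ B σ m ε x₀ t x xhat α q) (htm : t ≤ m) : q.length + t ≤ m := by
  induction h with
  | success => simp
  | solution ht hstep hsol => simp; omega
  | halt ht hstep hsol hprog => simp; omega
  | next ht hstep hsol hprog hnext ih => simp; have := ih (by omega); omega

theorem CubicStepsFrom.isApproxStationary {ψ : Vec n → EReal} {B : Matrix (Fin n) (Fin n) ℝ}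
    {σ ε : ℝ} {m t : ℕ} {x₀ x xhat : Vec n} {α : Status} {q : List (Vec n)}
    (h : CubicStepsFrom f ψ B σ m ε x₀ t x xhat α q) (hα : α = Status.solution) :
    IsApproxStationary f ψ ε xhat := by
  induction h with
  | success => cases hα
  | solution ht hstep hsol => exact ⟨_, hstep.subgradient, hsol⟩
  | halt ht hstep hsol hprog => cases hα
  | next ht hstep hsol hprog hnext ih => exact ih hα

theorem CubicStepsFrom.quota_mul_le {ψ : Vec n → EReal} {B : Matrix (Fin n) (Fin n) ℝ}
    {σ ε : ℝ} {m t : ℕ} {x₀ x xhat : Vec n} {α : Status} {q : List (Vec n)}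
    (h : CubicStepsFrom f ψ B σ m ε x₀ t x xhat α q) (hα : α = Status.success)
    (hx : quota σ ε * t ≤ objective f ψ x₀ - objective f ψ x) :
    quota σ ε * m ≤ objective f ψ x₀ - objective f ψ xhat := by
  induction h with
  | success => exact hx
  | solution ht hstep hsol => cases hα
  | halt ht hstep hsol hprog => cases hα
  | next ht hstep hsol hprog hnext ih =>
    refine ih hα ?_
    push_cast
    exact hprog

/-- If every step `r`, started at distance `d`, gains at least
`K + σ / 40 * (r ^ 3 - d ^ 3 / m ^ 3)`, with `K` the quota, then the accumulated gain
never falls below the quota: with `R` the sum of the cubes of the first `t` step lengths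
and `a` their mean, the gain is at least `K * t + σ / 40 * (1 - t / m) * R`. -/
theorem CubicStepsFrom.ne_halt {ψ : Vec n → EReal} {B : Matrix (Fin n) (Fin n) ℝ}
    {σ ε : ℝ} {m t : ℕ} {x₀ x xhat : Vec n} {α : Status} {q : List (Vec n)}
    (h : CubicStepsFrom f ψ B σ m ε x₀ t x xhat α q) (hσ : 0 < σ) (htm : t ≤ m)
    (hgain : ∀ y y' s, IsInexactCubicStep f ψ B σ y y' s → ¬ ‖gradient f y' + s‖ ≤ ε →
      quota σ ε + σ / 40 * (‖y' - y‖ ^ 3 - ‖y - x₀‖ ^ 3 / m ^ 3)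
        ≤ objective f ψ y - objective f ψ y')
    (hx : ∃ a R : ℝ, 0 ≤ a ∧ ‖x - x₀‖ ≤ t * a ∧ t * a ^ 3 ≤ R ∧
      quota σ ε * t + σ / 40 * (1 - t / m) * R ≤ objective f ψ x₀ - objective f ψ x) :
    α ≠ Status.halt := by
  -- one step preserves the bound on the accumulated gain
  have hone : ∀ (t : ℕ) (x x' s : Vec n), t < m → IsInexactCubicStep f ψ B σ x x' s →
      ¬ ‖gradient f x' + s‖ ≤ ε →
      (∃ a R : ℝ, 0 ≤ a ∧ ‖x - x₀‖ ≤ t * a ∧ t * a ^ 3 ≤ R ∧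
        quota σ ε * t + σ / 40 * (1 - t / m) * R ≤ objective f ψ x₀ - objective f ψ x) →
      ∃ a R : ℝ, 0 ≤ a ∧ ‖x' - x₀‖ ≤ ((t + 1 : ℕ) : ℝ) * a ∧ ((t + 1 : ℕ) : ℝ) * a ^ 3 ≤ R ∧
        quota σ ε * ((t + 1 : ℕ) : ℝ) + σ / 40 * (1 - ((t + 1 : ℕ) : ℝ) / m) * R
          ≤ objective f ψ x₀ - objective f ψ x' := by
    rintro t x x' s htm hstep hsol ⟨a, R, ha, hxa, haR, hF⟩
    have hm0 : (0 : ℝ) < m := by exact_mod_cast (by omega : 0 < m)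
    have ht1 : (t : ℝ) + 1 ≤ m := by exact_mod_cast htm
    have ht0 : (0 : ℝ) ≤ t := by positivity
    have hg := hgain x x' s hstep hsol
    set r := ‖x' - x‖ with hr
    have hr0 : 0 ≤ r := norm_nonneg _
    have hR0 : 0 ≤ R := le_trans (by positivity) haR
    push_cast
    refine ⟨(t * a + r) / (t + 1), R + r ^ 3, by positivity, ?_, ?_, ?_⟩
    · rw [mul_div_cancel₀ _ (by positivity)]
      calc ‖x' - x₀‖ = ‖(x - x₀) + (x' - x)‖ := by congr 1; abel
        _ ≤ _ := (norm_add_le _ _).trans (by gcongr)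
    · -- convexity of the cube
      have hc : (t * a + r) ^ 3 ≤ (t + 1) ^ 2 * (t * a ^ 3 + r ^ 3) := by
        have : 0 ≤ t * (a - r) ^ 2 * ((2 * t + 1) * a + (t + 2) * r) := by positivity
        nlinarith
      have : ((t : ℝ) + 1) * ((t * a + r) / (t + 1)) ^ 3 = (t * a + r) ^ 3 / (t + 1) ^ 2 := by
        field_simp
      rw [this, div_le_iff₀ (by positivity)]
      nlinarith [sq_nonneg ((t : ℝ) + 1)]
    · have hd : ‖x - x₀‖ ^ 3 / m ^ 3 ≤ R / m := by
        have h1 : ‖x - x₀‖ ^ 3 ≤ m ^ 2 * R := by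
          calc ‖x - x₀‖ ^ 3 ≤ (t * a) ^ 3 := by gcongr
            _ = t ^ 2 * (t * a ^ 3) := by ring
            _ ≤ m ^ 2 * R := by gcongr
        rw [div_le_div_iff₀ (by positivity) hm0]
        nlinarith
      have hloss : 0 ≤ σ / 40 * (((t : ℝ) + 1) / m * r ^ 3) := by positivity
      have hdσ := mul_le_mul_of_nonneg_left hd (show 0 ≤ σ / 40 by positivity)
      have e : σ / 40 * (1 - ((t : ℝ) + 1) / m) * (R + r ^ 3)
          = σ / 40 * (1 - t / m) * R - σ / 40 * (R / m) + σ / 40 * r ^ 3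
            - σ / 40 * (((t : ℝ) + 1) / m * r ^ 3) := by ring
      rw [e]
      linarith
  induction h with
  | success => simp
  | solution ht hstep hsol => simp
  | @halt t x x' s ht hstep hsol hprog =>
    exfalso
    have htm' : t < m := by omega
    obtain ⟨a, R, ha, -, haR, hF⟩ := hone t x x' s htm' hstep hsol hx
    refine hprog ?_
    have hm0 : (0 : ℝ) < m := by exact_mod_cast (by omega : 0 < m)
    have h1 : ((t + 1 : ℕ) : ℝ) / m ≤ 1 := by
      rw [div_le_one hm0]; exact_mod_cast htm'
    have hR0 : 0 ≤ R := le_trans (by positivity) haR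
    have h2 : 0 ≤ σ / 40 * (1 - ((t + 1 : ℕ) : ℝ) / m) * R :=
      mul_nonneg (mul_nonneg (by positivity) (by linarith)) hR0
    push_cast at hF h2
    show quota σ ε * _ ≤ _
    linarith
  | @next t x x' s xhat α q ht hstep hsol hprog hnext ih =>
    exact ih (by omega) (hone t x x' s (by omega) hstep hsol hx)

/-! ### The parameters of the method -/

theorem sigmaParam_pos {m : ℕ} (hm : 1 ≤ m) {τ : ℝ} (hτ : 0 < τ) (ℓ : ℕ) :
    0 < sigmaParam m τ ℓ := by
  have : (0 : ℝ) < m := by exact_mod_cast hm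
  unfold sigmaParam; positivity

theorem mul_le_sigmaParam {m : ℕ} {τ : ℝ} {ℓ : ℕ} (hL : 0 ≤ L) (hLτ : L ≤ 2 ^ ℓ * τ) :
    L * m ≤ sigmaParam m τ ℓ / 13 := by
  have hc : (13 / 16 : ℝ) ≤ (2 / 3 : ℝ) ^ (1 / 3 : ℝ) := by
    calc (13 / 16 : ℝ) = ((13 / 16 : ℝ) ^ 3) ^ (1 / 3 : ℝ) := by
          rw [← Real.rpow_natCast, ← Real.rpow_mul (by norm_num)]; norm_num
      _ ≤ _ := Real.rpow_le_rpow (by norm_num) (by norm_num) (by norm_num)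
  have hτ : 0 ≤ 2 ^ ℓ * τ := hL.trans hLτ
  have h1 : L * m ≤ 2 ^ ℓ * τ * m := by gcongr
  have h2 : 0 ≤ 2 ^ ℓ * τ * m := by positivity
  unfold sigmaParam
  nlinarith

/-- The step `h` of the finite differences is chosen so that the cube of their error is a small
fraction of `σ ^ 2` times the quota. -/
theorem fd_error_pow_three_le {n m : ℕ} (hn : 1 ≤ n) (hm : 1 ≤ m) {ε τ : ℝ} {ℓ : ℕ} (hε : 0 < ε)
    (hτ : 0 < τ) (hL : 0 ≤ L) (hLτ : L ≤ 2 ^ ℓ * τ) :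
    (√(n : ℝ) * (L * hParam n m ε τ ℓ / 2)) ^ 3
      ≤ sigmaParam m τ ℓ ^ 2 * quota (sigmaParam m τ ℓ) ε / 170 := by
  have hσ := sigmaParam_pos hm hτ ℓ
  set σ := sigmaParam m τ ℓ with hσd
  have hn0 : (0 : ℝ) < n := by exact_mod_cast hn
  set z := 2 ^ ℓ * τ with hz
  have hz0 : 0 < z := by positivity
  have hh : hParam n m ε τ ℓ ^ 3 = 3 * σ ^ (3 / 2 : ℝ) * ε ^ (3 / 2 : ℝ) /
      (2 ^ 7 * 192 * (n : ℝ) ^ (3 / 2 : ℝ) * z ^ 3) := by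
    rw [hParam, ← hσd, ← hz, ← Real.rpow_natCast, ← Real.rpow_mul (by positivity)]
    norm_num
  have hsn : √(n : ℝ) ^ 3 = (n : ℝ) ^ (3 / 2 : ℝ) := by
    rw [Real.sqrt_eq_rpow, ← Real.rpow_natCast, ← Real.rpow_mul hn0.le]
    norm_num
  have hσ2 : σ ^ (3 / 2 : ℝ) * σ ^ (1 / 2 : ℝ) = σ ^ 2 := by
    rw [← Real.rpow_add hσ, ← Real.rpow_natCast]
    norm_num
  have hh0 : 0 ≤ hParam n m ε τ ℓ := by unfold hParam; positivity
  calc (√(n : ℝ) * (L * hParam n m ε τ ℓ / 2)) ^ 3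
      ≤ (√(n : ℝ) * (z * hParam n m ε τ ℓ / 2)) ^ 3 := by gcongr
    _ = (n : ℝ) ^ (3 / 2 : ℝ) * z ^ 3 * (hParam n m ε τ ℓ ^ 3) / 8 := by
        rw [mul_pow, hsn]; ring
    _ = σ ^ (3 / 2 : ℝ) * ε ^ (3 / 2 : ℝ) / 65536 := by
        rw [hh]
        field_simp
        norm_num
    _ ≤ σ ^ 2 * quota σ ε / 170 := by
        have e : σ ^ 2 * quota σ ε = σ ^ (3 / 2 : ℝ) * ε ^ (3 / 2 : ℝ) / 384 := by
          rw [quota, ← hσ2]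
          field_simp
        have : 0 ≤ σ ^ (3 / 2 : ℝ) * ε ^ (3 / 2 : ℝ) := by positivity
        rw [e]
        linarith

theorem hParam_pos {n m : ℕ} (hn : 1 ≤ n) (hm : 1 ≤ m) {ε τ : ℝ} {ℓ : ℕ} (hε : 0 < ε)
    (hτ : 0 < τ) : 0 < hParam n m ε τ ℓ := by
  have hσ := sigmaParam_pos hm hτ ℓ
  have hn0 : (0 : ℝ) < n := by exact_mod_cast hn
  unfold hParam; positivity

/-- `CubicSteps` does not halt once the regularization dominates the Lipschitz constant. -/
theorem InnerCall.ne_halt {ψ : Vec n → EReal} {m : ℕ} {ε : ℝ} {S : State n} {xhat : Vec n}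
    {α : Status} {q : List (Vec n)} (h : InnerCall f ψ m ε S xhat α q) (hm : 1 ≤ m)
    (hf : ContDiff ℝ 2 f) (hA1 : LipschitzHessian f L) (hε : 0 < ε) (hτ : 0 < S.τ) (hL : 0 ≤ L)
    (hLτ : L ≤ 2 ^ S.ℓ * S.τ) : α ≠ Status.halt := by
  have hσ := sigmaParam_pos hm hτ S.ℓ
  refine CubicStepsFrom.ne_halt h hσ (Nat.zero_le _) (fun y y' s hstep hsol => ?_)
    ⟨0, 0, le_rfl, by simp, by simp, by simp⟩
  -- for `n = 0` the parameter `h` has the junk value `0`, but every point is stationary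
  rcases Nat.eq_zero_or_pos n with rfl | hn
  · refine absurd ?_ hsol
    rw [Subsingleton.elim (gradient f y' + s) 0, norm_zero]
    exact hε.le
  have hh := hParam_pos hn hm (ε := ε) (ℓ := S.ℓ) hε hτ
  set δ := √(n : ℝ) * (L * hParam n m ε S.τ S.ℓ / 2) with hδ
  set T := Matrix.toEuclideanCLM (n := Fin n) (𝕜 := ℝ) (fdHessian f S.x (hParam n m ε S.τ S.ℓ))
  -- error of the lazy matrix at `y`: finite differences at `S.x`, plus the drift of the Hessian
  have hE : ‖T - hessian f y‖ ≤ δ + L * ‖y - S.x‖ := by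
    rw [← sub_add_sub_cancel T (hessian f S.x)]
    refine (norm_add_le _ _).trans (add_le_add
      (norm_fdHessian_sub_hessian_le hf hA1 S.x hL hh) ?_)
    rw [norm_sub_rev]
    exact hA1 _ _
  obtain ⟨hD, hg⟩ := step_decrease_and_gradient_le hf hA1 (adjoint_fdHessian _ _) hE hσ.le hstep
  exact quota_add_le hm hσ hε hL (mul_le_sigmaParam hL hLτ) (by positivity)
    (fd_error_pow_three_le hn hm hε hτ hL hLτ) (norm_nonneg _) (norm_nonneg _) hD
    ((not_le.1 hsol).le.trans hg)

/-! ### Executions of the method -/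

/-- A lower bound on the decrease of the objective in one successful outer iteration, valid as long
as `2 ^ ℓ * τ ≤ 2 * M`. -/
noncomputable def outerQuota (m : ℕ) (M ε : ℝ) : ℝ :=
  √(m : ℝ) * ε ^ (3 / 2 : ℝ)
    / (384 * 2 ^ (5 / 2 : ℝ) * (2 / 3 : ℝ) ^ (1 / 6 : ℝ) * M ^ (1 / 2 : ℝ))

theorem outerQuota_pos {m : ℕ} (hm : 1 ≤ m) {M ε : ℝ} (hM : 0 < M) (hε : 0 < ε) :
    0 < outerQuota m M ε := by
  have : (0 : ℝ) < m := by exact_mod_cast hm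
  unfold outerQuota; positivity

theorem outerQuota_le {m : ℕ} (hm : 1 ≤ m) {M ε τ : ℝ} {ℓ : ℕ} (hM : 0 < M) (hε : 0 < ε)
    (hτ : 0 < τ) (h : 2 ^ ℓ * τ ≤ 2 * M) :
    outerQuota m M ε ≤ quota (sigmaParam m τ ℓ) ε * m := by
  have hm0 : (0 : ℝ) < m := by exact_mod_cast hm
  have hσ := sigmaParam_pos hm hτ ℓ
  have hle : sigmaParam m τ ℓ ≤ 2 ^ 5 * (2 / 3 : ℝ) ^ (1 / 3 : ℝ) * M * m := by
    calc sigmaParam m τ ℓ ≤ 2 ^ 4 * (2 / 3 : ℝ) ^ (1 / 3 : ℝ) * (2 * M) * m := by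
          unfold sigmaParam; gcongr
      _ = _ := by ring
  have hroot : (2 ^ 5 * (2 / 3 : ℝ) ^ (1 / 3 : ℝ) * M * m) ^ (1 / 2 : ℝ)
      = 2 ^ (5 / 2 : ℝ) * (2 / 3 : ℝ) ^ (1 / 6 : ℝ) * M ^ (1 / 2 : ℝ) * √(m : ℝ) := by
    rw [Real.mul_rpow (by positivity) (by positivity),
      Real.mul_rpow (by positivity) (by positivity),
      Real.mul_rpow (by positivity) (by positivity), ← Real.rpow_mul (by positivity),
      ← Real.rpow_natCast, ← Real.rpow_mul (by positivity), Real.sqrt_eq_rpow]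
    norm_num
  have hq : ε ^ (3 / 2 : ℝ) / (384 * (2 ^ 5 * (2 / 3 : ℝ) ^ (1 / 3 : ℝ) * M * m) ^ (1 / 2 : ℝ))
      ≤ quota (sigmaParam m τ ℓ) ε := by
    unfold quota; gcongr
  refine le_trans (le_of_eq ?_) (mul_le_mul_of_nonneg_right hq hm0.le)
  have hsq : (m : ℝ) = √(m : ℝ) * √(m : ℝ) := (Real.mul_self_sqrt hm0.le).symm
  rw [hroot, outerQuota, div_mul_eq_mul_div, div_eq_div_iff (by positivity) (by positivity)]
  conv_rhs => rw [hsq]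
  ring

theorem length_attemptQueries (m : ℕ) (ε : ℝ) (S : State n) (q : List (Vec n)) :
    (attemptQueries m ε S q).length = (if S.ℓ = 0 then 1 else 0) + n + 2 + q.length := by
  unfold attemptQueries
  split_ifs <;> simp <;> omega

/-- What every state of an execution satisfies. While the method is running, the outer iterations
made so far have each decreased the objective by the `outerQuota`, and the oracle calls are charged
to the outer iterations and to the growth of `2 ^ ℓ * τ`. -/
structure Invariant (f : Vec n → ℝ) (ψ : Vec n → EReal) (m : ℕ) (L τ₀ ε : ℝ) (x₀ : Vec n)
    (S : State n) : Prop where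
  mem_dom : S.x ∈ dom ψ
  le_tau : τ₀ ≤ S.τ
  tau_le : S.τ ≤ max τ₀ L
  pow_mul_tau_le : 2 ^ S.ℓ * S.τ ≤ 2 * max τ₀ L
  running_decrease : S.stopped = false →
    outerQuota m (max τ₀ L) ε * S.k ≤ objective f ψ x₀ - objective f ψ S.x
  running_queries : S.stopped = false →
    (S.queries.length : ℝ) ≤ (5 + 2 * ((n : ℝ) + m)) * S.k
      + (2 + (n : ℝ) + m) * Real.logb 2 (2 ^ S.ℓ * S.τ / τ₀) + (if S.ℓ = 0 then 0 else 1)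
  stopped_stationary : S.stopped = true → IsApproxStationary f ψ ε S.x
  stopped_decrease : S.stopped = true →
    outerQuota m (max τ₀ L) ε * (S.k - 1) ≤ objective f ψ x₀ - optimalValue f ψ
  stopped_queries : S.stopped = true →
    (S.queries.length : ℝ) ≤ (5 + 2 * ((n : ℝ) + m)) * S.k
      + (2 + (n : ℝ) + m) * Real.logb 2 (max τ₀ L / τ₀)

variable {ψ : Vec n → EReal} {m : ℕ} {τ₀ ε : ℝ} {x₀ : Vec n}

theorem optimalValue_le (hbdd : BddBelow (objective f ψ '' dom ψ)) {x : Vec n} (hx : x ∈ dom ψ) :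
    optimalValue f ψ ≤ objective f ψ x :=
  csInf_le hbdd ⟨x, hx, rfl⟩

theorem logb_two_mul_div {a : ℝ} (ha : 0 < a) (hτ₀ : 0 < τ₀) :
    Real.logb 2 (2 * a / τ₀) = 1 + Real.logb 2 (a / τ₀) := by
  rw [mul_div_assoc, Real.logb_mul (by norm_num) (by positivity),
    Real.logb_self_eq_one (by norm_num)]

/-- A halt forces `2 ^ ℓ * τ < L`, so that doubling keeps `2 ^ ℓ * τ ≤ 2 * max τ₀ L`. It raises
the logarithm by one, which pays for the attempt. A success lowers the logarithm by at most one; the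
coefficient `5 + 2 * (n + m) = 1 + 2 * (2 + n + m)` of `k` covers this loss, the calls of the
attempt and the call that opens the iteration. -/
theorem Invariant.attempt {S S' : State n} (hS : Invariant f ψ m L τ₀ ε x₀ S) (hm : 1 ≤ m)
    (hf : ContDiff ℝ 2 f) (hA1 : LipschitzHessian f L)
    (hbdd : BddBelow (objective f ψ '' dom ψ)) (hL : 0 ≤ L) (hτ₀ : 0 < τ₀) (hε : 0 < ε)
    (hrun : S.stopped = false) (h : Attempt f ψ m τ₀ ε S S') :
    Invariant f ψ m L τ₀ ε x₀ S' := by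
  have hτ : 0 < S.τ := hτ₀.trans_le hS.le_tau
  have hM : 0 < max τ₀ L := lt_max_of_lt_left hτ₀
  have hF := hS.running_decrease hrun
  have hQ := hS.running_queries hrun
  -- the oracle calls of the attempt
  have hlen : ∀ {xhat : Vec n} {α : Status} {q : List (Vec n)}, InnerCall f ψ m ε S xhat α q →
      ((S.queries ++ attemptQueries m ε S q).length : ℝ) ≤ (5 + 2 * ((n : ℝ) + m)) * S.k
        + (2 + (n : ℝ) + m) * Real.logb 2 (2 ^ S.ℓ * S.τ / τ₀) + 1 + (2 + (n : ℝ) + m) := by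
    intro xhat α q hi
    have hq : (q.length : ℝ) ≤ m := by exact_mod_cast CubicStepsFrom.length_le hi (Nat.zero_le m)
    rw [List.length_append, length_attemptQueries]
    push_cast
    split_ifs at hQ ⊢ <;> linarith
  have hz : 0 < 2 ^ S.ℓ * S.τ := by positivity
  cases h with
  | @halt xhat q h =>
    have hlt : 2 ^ S.ℓ * S.τ < L := by
      by_contra! hle
      exact h.ne_halt hm hf hA1 hε hτ hL hle rfl
    refine ⟨hS.mem_dom, hS.le_tau, hS.tau_le, ?_, fun _ => hF, fun _ => ?_, by simp, by simp,
      by simp⟩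
    · have := le_max_right τ₀ L
      rw [pow_succ']
      linarith
    · have := hlen h
      rw [if_neg (Nat.succ_ne_zero _), pow_succ', mul_assoc 2 _ S.τ, logb_two_mul_div hz hτ₀]
      linarith
  | @success xhat q h =>
    have hdec := CubicStepsFrom.quota_mul_le h rfl (by simp)
    have hquota := outerQuota_le hm hM hε hτ hS.pow_mul_tau_le
    have hpow : (2 : ℝ) ^ ((S.ℓ : ℤ) - 1) * S.τ = 2 ^ S.ℓ * S.τ / 2 := by
      rw [zpow_sub_one₀ (by norm_num), zpow_natCast]; ring
    have hmax : max τ₀ ((2 : ℝ) ^ ((S.ℓ : ℤ) - 1) * S.τ) ≤ max τ₀ L := by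
      refine max_le (le_max_left _ _) ?_
      rw [hpow]
      linarith [hS.pow_mul_tau_le]
    refine ⟨CubicStepsFrom.mem_dom h hS.mem_dom, le_max_left _ _, hmax, ?_, fun _ => ?_,
      fun _ => ?_, by simp, by simp, by simp⟩
    · simp only [pow_zero, one_mul]
      linarith
    · push_cast
      linarith
    · have h1 := hlen h
      have hz' : 0 < max τ₀ ((2 : ℝ) ^ ((S.ℓ : ℤ) - 1) * S.τ) := lt_max_of_lt_left hτ₀
      have h2 : Real.logb 2 (2 ^ S.ℓ * S.τ / τ₀)
          ≤ 1 + Real.logb 2 (max τ₀ ((2 : ℝ) ^ ((S.ℓ : ℤ) - 1) * S.τ) / τ₀) := by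
        rw [← logb_two_mul_div hz' hτ₀]
        refine Real.logb_le_logb_of_le (by norm_num) (by positivity)
          (div_le_div_of_nonneg_right ?_ hτ₀.le)
        have := le_max_right τ₀ ((2 : ℝ) ^ ((S.ℓ : ℤ) - 1) * S.τ)
        linarith
      have h3 := mul_le_mul_of_nonneg_left h2 (show 0 ≤ 2 + (n : ℝ) + m by positivity)
      simp only [pow_zero, one_mul, if_true]
      push_cast at h1 ⊢
      linarith
  | @solution xhat q h =>
    refine ⟨CubicStepsFrom.mem_dom h hS.mem_dom, hS.le_tau, hS.tau_le, ?_, by simp, by simp,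
      fun _ => CubicStepsFrom.isApproxStationary h rfl, fun _ => ?_, fun _ => ?_⟩
    · simp only [pow_zero, one_mul]
      linarith [hS.tau_le]
    · have := optimalValue_le hbdd hS.mem_dom
      push_cast
      linarith
    · have h1 := hlen h
      have h2 : Real.logb 2 (2 ^ S.ℓ * S.τ / τ₀) ≤ 1 + Real.logb 2 (max τ₀ L / τ₀) := by
        rw [← logb_two_mul_div hM hτ₀]
        refine Real.logb_le_logb_of_le (by norm_num) (by positivity)
          (div_le_div_of_nonneg_right hS.pow_mul_tau_le hτ₀.le)
      have h3 := mul_le_mul_of_nonneg_left h2 (show 0 ≤ 2 + (n : ℝ) + m by positivity)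
      push_cast at h1 ⊢
      linarith

theorem IsExecution.invariant {S : ℕ → State n} (hS : IsExecution f ψ m τ₀ ε x₀ S) (hm : 1 ≤ m)
    (hf : ContDiff ℝ 2 f) (hA1 : LipschitzHessian f L)
    (hbdd : BddBelow (objective f ψ '' dom ψ)) (hL : 0 ≤ L) (hτ₀ : 0 < τ₀) (hε : 0 < ε)
    (hx₀ : x₀ ∈ dom ψ) (j : ℕ) : Invariant f ψ m L τ₀ ε x₀ (S j) := by
  induction j with
  | zero =>
    rw [hS.start]
    have : τ₀ ≤ max τ₀ L := le_max_left _ _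
    refine ⟨hx₀, le_rfl, this, ?_, by simp, ?_, by simp, by simp, by simp⟩
    · simp only [pow_zero, one_mul]
      linarith
    · simp [hτ₀.ne']
  | succ j ih =>
    cases hst : (S j).stopped with
    | true => rw [hS.ended j hst]; exact ih
    | false => exact ih.attempt hm hf hA1 hbdd hL hτ₀ hε hst (hS.running j hst)

/-- Every attempt calls the oracle, while the calls of a running method are bounded. -/
theorem IsExecution.exists_stopped {S : ℕ → State n} (hS : IsExecution f ψ m τ₀ ε x₀ S)
    (hm : 1 ≤ m) (hf : ContDiff ℝ 2 f) (hA1 : LipschitzHessian f L)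
    (hbdd : BddBelow (objective f ψ '' dom ψ)) (hL : 0 ≤ L) (hτ₀ : 0 < τ₀) (hε : 0 < ε)
    (hx₀ : x₀ ∈ dom ψ) : ∃ j, (S j).stopped = true := by
  by_contra! hrun
  simp only [ne_eq, Bool.not_eq_true] at hrun
  have hlen : ∀ j, j ≤ (S j).queries.length := by
    intro j
    induction j with
    | zero => simp
    | succ j ih =>
      have := hS.running j (hrun j)
      generalize S (j + 1) = S' at this
      cases this <;> simp only [List.length_append, length_attemptQueries] <;> omega
  have hM : 0 < max τ₀ L := lt_max_of_lt_left hτ₀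
  have hq := outerQuota_pos hm hM hε
  set q := outerQuota m (max τ₀ L) ε with hq'
  obtain ⟨j, hj⟩ := exists_nat_gt ((5 + 2 * ((n : ℝ) + m)) *
    ((objective f ψ x₀ - optimalValue f ψ) / q)
      + (2 + (n : ℝ) + m) * Real.logb 2 (2 * max τ₀ L / τ₀) + 1)
  have hI := hS.invariant hm hf hA1 hbdd hL hτ₀ hε hx₀ j
  have hk : ((S j).k : ℝ) ≤ (objective f ψ x₀ - optimalValue f ψ) / q := by
    rw [le_div_iff₀ hq, mul_comm]
    exact (hI.running_decrease (hrun j)).trans (by linarith [optimalValue_le hbdd hI.mem_dom])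
  have hτ : 0 < (S j).τ := hτ₀.trans_le hI.le_tau
  have hlog : Real.logb 2 (2 ^ (S j).ℓ * (S j).τ / τ₀) ≤ Real.logb 2 (2 * max τ₀ L / τ₀) := by
    refine Real.logb_le_logb_of_le (by norm_num) (by positivity)
      (div_le_div_of_nonneg_right hI.pow_mul_tau_le hτ₀.le)
  have h1 := hI.running_queries (hrun j)
  have h2 : (if (S j).ℓ = 0 then (0 : ℝ) else 1) ≤ 1 := by split_ifs <;> norm_num
  have h3 : (j : ℝ) ≤ (S j).queries.length := by exact_mod_cast hlen j
  have h4 := mul_le_mul_of_nonneg_left hk (show 0 ≤ 5 + 2 * ((n : ℝ) + m) by positivity)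
  have h5 := mul_le_mul_of_nonneg_left hlog (show 0 ≤ 2 + (n : ℝ) + m by positivity)
  linarith

theorem IsExecution.monotone_k {S : ℕ → State n} (hS : IsExecution f ψ m τ₀ ε x₀ S) :
    Monotone fun j => (S j).k := by
  refine monotone_nat_of_le_succ fun j => ?_
  cases hst : (S j).stopped with
  | true => rw [hS.ended j hst]
  | false =>
    have := hS.running j hst
    generalize S (j + 1) = S' at this
    cases this <;> simp

theorem IsExecution.eq_zero_or_x_eq {S : ℕ → State n} (hS : IsExecution f ψ m τ₀ ε x₀ S)
    (j : ℕ) : (S (j + 1)).ℓ = 0 ∨ (S (j + 1)).x = (S j).x := by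
  cases hst : (S j).stopped with
  | true => rw [hS.ended j hst]; exact Or.inr rfl
  | false =>
    have := hS.running j hst
    generalize S (j + 1) = S' at this
    cases this <;> simp

end LazyCNM

theorem mainTheorem2 (n m : ℕ) (hm : 1 ≤ m)
    (f : LazyCNM.Vec n → ℝ) (ψ : LazyCNM.Vec n → EReal) (L τ₀ ε : ℝ) (x₀ : LazyCNM.Vec n)
    (hf : ContDiff ℝ 2 f) (hψ : LazyCNM.ProperClosedConvex ψ)
    (hbdd : BddBelow (LazyCNM.objective f ψ '' LazyCNM.dom ψ))
    (hL : 0 ≤ L) (hA1 : LazyCNM.LipschitzHessian f L)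
    (hτ₀ : 0 < τ₀) (hε : 0 < ε) (hx₀ : x₀ ∈ LazyCNM.dom ψ)
    (S : ℕ → LazyCNM.State n) (hS : LazyCNM.IsExecution f ψ m τ₀ ε x₀ S) :
    -- `S j` is the state in which `x_T` has just been computed, `T = T(ε)`
    ∃ T j : ℕ, (S j).k = T ∧ (S j).ℓ = 0 ∧
      LazyCNM.IsApproxStationary f ψ ε (S j).x ∧
      (∀ i, (S i).k < T → ¬ LazyCNM.IsApproxStationary f ψ ε (S i).x) ∧
      (T : ℝ) ≤
        384 * 2 ^ (5 / 2 : ℝ) * (2 / 3 : ℝ) ^ (1 / 6 : ℝ) * (max τ₀ L) ^ (1 / 2 : ℝ)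
            * (LazyCNM.objective f ψ x₀ - LazyCNM.optimalValue f ψ) / √(m : ℝ)
            * ε ^ (-(3 / 2) : ℝ)
          + (if (S j).stopped then 1 else 0) ∧
      ((S j).queries.length : ℝ) ≤
        (5 + 2 * ((n : ℝ) + m)) / √(m : ℝ)
            * (384 * 2 ^ (5 / 2 : ℝ) * (2 / 3 : ℝ) ^ (1 / 6 : ℝ)) * (max τ₀ L) ^ (1 / 2 : ℝ)
            * (LazyCNM.objective f ψ x₀ - LazyCNM.optimalValue f ψ) * ε ^ (-(3 / 2) : ℝ)
          + (2 + (n : ℝ) + m) * Real.logb 2 (max τ₀ L / τ₀)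
          + (5 + 2 * ((n : ℝ) + m)) * (if (S j).stopped then 1 else 0) := by
  classical
  have hinv := hS.invariant hm hf hA1 hbdd hL hτ₀ hε hx₀
  obtain ⟨j₁, hj₁⟩ := hS.exists_stopped hm hf hA1 hbdd hL hτ₀ hε hx₀
  have hex : ∃ j, LazyCNM.IsApproxStationary f ψ ε (S j).x :=
    ⟨j₁, (hinv j₁).stopped_stationary hj₁⟩
  -- the first state with an approximately stationary iterate
  obtain ⟨j, hj, hmin⟩ : ∃ j, LazyCNM.IsApproxStationary f ψ ε (S j).x ∧
      ∀ i < j, ¬ LazyCNM.IsApproxStationary f ψ ε (S i).x :=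
    ⟨Nat.find hex, Nat.find_spec hex, fun i hi => Nat.find_min hex hi⟩
  have hℓ : (S j).ℓ = 0 := by
    cases j with
    | zero => rw [hS.start]
    | succ i =>
      refine (hS.eq_zero_or_x_eq i).resolve_right fun hx => hmin i (Nat.lt_succ_self i) ?_
      rwa [← hx]
  have hI := hinv j
  have hM : 0 < max τ₀ L := lt_max_of_lt_left hτ₀
  have hm0 : (0 : ℝ) < m := by exact_mod_cast hm
  have hq := LazyCNM.outerQuota_pos hm hM hε
  set Δ := LazyCNM.objective f ψ x₀ - LazyCNM.optimalValue f ψ with hΔ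
  set C := 384 * 2 ^ (5 / 2 : ℝ) * (2 / 3 : ℝ) ^ (1 / 6 : ℝ) * (max τ₀ L) ^ (1 / 2 : ℝ)
            * Δ / √(m : ℝ) * ε ^ (-(3 / 2) : ℝ) with hC
  have hCq : C = Δ / LazyCNM.outerQuota m (max τ₀ L) ε := by
    rw [hC, LazyCNM.outerQuota, Real.rpow_neg hε.le]
    field_simp
  have hT : ((S j).k : ℝ) ≤ C + (if (S j).stopped then 1 else 0) := by
    cases hst : (S j).stopped with
    | true =>
      have : ((S j).k : ℝ) - 1 ≤ C := by
        rw [hCq, le_div_iff₀ hq, mul_comm]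
        exact hI.stopped_decrease hst
      simp only [if_true]
      linarith
    | false =>
      have : ((S j).k : ℝ) ≤ C := by
        rw [hCq, le_div_iff₀ hq, mul_comm]
        exact (hI.running_decrease hst).trans
          (by linarith [LazyCNM.optimalValue_le hbdd hI.mem_dom])
      simpa using this
  have hN : (0 : ℝ) ≤ 2 + (n : ℝ) + m := by positivity
  have hQ : ((S j).queries.length : ℝ) ≤ (5 + 2 * ((n : ℝ) + m)) * (S j).k
      + (2 + (n : ℝ) + m) * Real.logb 2 (max τ₀ L / τ₀) := by
    cases hst : (S j).stopped with
    | true => exact hI.stopped_queries hst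
    | false =>
      have h1 := hI.running_queries hst
      simp only [hℓ, pow_zero, one_mul, if_true, add_zero] at h1
      have hτ : 0 < (S j).τ := hτ₀.trans_le hI.le_tau
      have hlog : Real.logb 2 ((S j).τ / τ₀) ≤ Real.logb 2 (max τ₀ L / τ₀) := by
        refine Real.logb_le_logb_of_le (by norm_num) (by positivity) ?_
        gcongr
        exact hI.tau_le
      linarith [mul_le_mul_of_nonneg_left hlog hN]
  refine ⟨(S j).k, j, rfl, hℓ, hj, fun i hi => hmin i ?_, hT, ?_⟩
  · by_contra! hji
    exact absurd (hS.monotone_k hji) (not_le.2 hi)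
  · have h1 := mul_le_mul_of_nonneg_left hT (show 0 ≤ 5 + 2 * ((n : ℝ) + m) by positivity)
    have e : (5 + 2 * ((n : ℝ) + m)) / √(m : ℝ)
            * (384 * 2 ^ (5 / 2 : ℝ) * (2 / 3 : ℝ) ^ (1 / 6 : ℝ)) * (max τ₀ L) ^ (1 / 2 : ℝ)
            * Δ * ε ^ (-(3 / 2) : ℝ) = (5 + 2 * ((n : ℝ) + m)) * C := by
      rw [hC]; ring
    rw [e]
    linarith
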